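/- Let $L$ be a finite-dimensional Lie algebra over a field $F$. For a Lie algebra $U$ let $N(U)$ denote its nilradical, the largest nilpotent ideal of $U$. Put $U^1=U$ and $U^{k+1}=[U^k,U]$ for $k\ge 1$; a Lie algebra $U \neq 0$ has nilpotency class $n$ if $U^n\neq 0$ and $U^{n+1}=0$, and the zero algebra has nilpotency class $0$. A subalgebra $U$ of $L$ is called nilregular if either $F$ has characteristic $0$, or $F$ has characteristic $p>0$ and $N(U)$ has nilpotency class less than $p-1$. A subalgebra $I$ of $L$ is called a subideal of $L$ if there are $n\ge 0$ and a chain of subalgebras $I=I_0<I_1<\dots<I_n=L$ such that $I_j$ is an ideal of $I_{j+1}$ for each $0\le j\le n-1$. Then: (i) If $I$ is a nilregular ideal of $L$, then $N(I)\subseteq N(L)$. (ii) If $I$ is a nilregular subideal of $L$ and every subideal of $L$ containing $I$ is nilregular, then $N(I)\subseteq N(L)$. -/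

import Mathlib

/-- The nilradical `N(L)` of a Lie algebra `L`: the sum of all ideals of `L` that are nilpotent as Lie
algebras in their own right (for finite-dimensional `L` this is the largest nilpotent ideal). Mathlib's
`LieAlgebra.maxNilpotentIdeal` is a different object: it uses ideals on which all of `L` acts
nilpotently. -/
def lieNilradical (F L : Type*) [Field F] [LieRing L] [LieAlgebra F L] : LieIdeal F L :=
  sSup {I : LieIdeal F L | LieRing.IsNilpotent I}

/-- `L` has nilpotency class `n`: writing `L¹ = L` and `L^(k+1) = [L^k, L]`, we have `L^(n+1) = 0` and no
earlier term is zero. Mathlib's `lowerCentralSeries` is indexed from `0`, so its `k`-th term is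
`L^(k+1)`. The zero algebra has class `0`. -/
def HasNilpotencyClass (F L : Type*) [Field F] [LieRing L] [LieAlgebra F L] (n : ℕ) : Prop :=
  LieModule.lowerCentralSeries F L L n = ⊥ ∧
    ∀ m < n, LieModule.lowerCentralSeries F L L m ≠ ⊥

/-- `U` is nilregular: if `F` has characteristic `p > 0`, then the nilradical of `U` has nilpotency class
less than `p - 1` (no condition in characteristic zero). -/
def IsNilregular (F U : Type*) [Field F] [LieRing U] [LieAlgebra F U] : Prop :=
  ∀ p : ℕ, 0 < p → CharP F p → ∃ n : ℕ, n < p - 1 ∧ HasNilpotencyClass F (lieNilradical F U) n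

/-- `I` is a subideal of `L`: there is a chain of subalgebras `I = C 0 < C 1 < ⋯ < C n = L` with each
`C j` an ideal of `C (j + 1)`. -/
def IsSubideal {F L : Type*} [Field F] [LieRing L] [LieAlgebra F L] (I : LieSubalgebra F L) : Prop :=
  ∃ (n : ℕ) (C : ℕ → LieSubalgebra F L), C 0 = I ∧ C n = ⊤ ∧
    ∀ j < n, C j < C (j + 1) ∧ ∀ x ∈ C (j + 1), ∀ y ∈ C j, ⁅x, y⁆ ∈ C j

/-! The core is that a maximal nilpotent ideal `N` of `U`, of small class, is stable under every
derivation `D` of `U`; if `U` is an ideal of `L`, then `N` is an ideal of `L` too, hence lies in the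
nilradical.

Let `N` have class at most `c` and put `n = c + 1`. A product of `n` maps `ad a` with `a ∈ N` is
zero. Apply `[D, ·]` to it `n` times: modulo maps sending each `N.lcs` term into the next, only the
terms with every factor differentiated once survive, and they give `n! ad (D a₁) ⋯ ad (D aₙ)`. Since
`n! ≠ 0` in `F`, any `n` maps `ad x` with `x ∈ N + D N` compose to a map one step down the
filtration. So `N + D N` is nilpotent (`LieIdeal.isNilpotent_addDerivation`), and maximality forces
`D N ⊆ N`. Part (ii) climbs the chain one inclusion at a time. -/

/-! ### Iterated derivations of products -/

open Finset in
/-- The iterated Leibniz rule for a derivation of a noncommutative ring. -/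
theorem iterate_leibniz {A : Type*} [Ring A] (δ : A →+ A)
    (hδ : ∀ a b, δ (a * b) = δ a * b + a * δ b) (n : ℕ) (a b : A) :
    δ^[n] (a * b) = ∑ ij ∈ antidiagonal n, n.choose ij.1 • (δ^[ij.1] a * δ^[ij.2] b) := by
  induction n with
  | zero => simp
  | succ n ih =>
    rw [sum_antidiagonal_choose_succ_nsmul (M := A) (fun i j => δ^[i] a * δ^[j] b) n]
    simp only [Function.iterate_succ_apply', ih, map_sum, map_nsmul, hδ, smul_add,
      sum_add_distrib]
    rw [add_comm, add_right_inj]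
    refine sum_congr rfl fun ⟨i, j⟩ hij ↦ ?_
    rw [n.choose_symm_of_eq_add (mem_antidiagonal.1 hij).symm]

/-- Let `J` be a two-sided ideal of a subring `R`, and let `δ` be a derivation. For elements `X` of `J`
all of whose iterated derivatives lie in `R`, the `n`-th derivative of a product of `n` such elements
is `n!` times the product of their derivatives modulo `J`; the factors `δ X` may be changed
by elements of `J`. -/
theorem iterate_derivation_list_prod {A : Type*} [Ring A] (δ : A →+ A)
    (hδ : ∀ a b, δ (a * b) = δ a * b + a * δ b) (R : Subring A) (J : AddSubgroup A)
    (hJR : ∀ j ∈ J, j ∈ R) (hl : ∀ r ∈ R, ∀ j ∈ J, r * j ∈ J) (hr : ∀ r ∈ R, ∀ j ∈ J, j * r ∈ J)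
    (l : List (A × A)) (h : ∀ q ∈ l, q.1 ∈ J ∧ (∀ k, δ^[k] q.1 ∈ R) ∧ q.2 - δ q.1 ∈ J) :
    (∀ m, δ^[m] (l.map Prod.fst).prod ∈ R) ∧
    (∀ m < l.length, δ^[m] (l.map Prod.fst).prod ∈ J) ∧
    (l.map Prod.snd).prod ∈ R ∧
    δ^[l.length] (l.map Prod.fst).prod - l.length.factorial • (l.map Prod.snd).prod ∈ J := by
  induction l with
  | nil =>
    have h1 : δ 1 = 0 := by simpa using hδ 1 1
    refine ⟨fun m => ?_, by simp, by simp [R.one_mem], by simp⟩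
    cases m with
    | zero => simp [R.one_mem]
    | succ m =>
      simp only [List.map_nil, List.prod_nil, Function.iterate_succ_apply, h1]
      rw [Function.iterate_fixed (map_zero δ)]
      exact R.zero_mem
  | cons q l ih =>
    obtain ⟨ihR, ihJ, ihQ, ihd⟩ := ih fun q hq => h q (List.mem_cons_of_mem _ hq)
    obtain ⟨hq1, hqR, hq2⟩ := h q List.mem_cons_self
    have hq2R : q.2 ∈ R := by simpa using R.add_mem (hJR _ hq2) (hqR 1)
    simp only [List.map_cons, List.prod_cons, List.length_cons]
    set P := (l.map Prod.fst).prod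
    set Q := (l.map Prod.snd).prod
    refine ⟨fun m => ?_, fun m hm => ?_, R.mul_mem hq2R ihQ, ?_⟩
    · rw [iterate_leibniz δ hδ]
      exact sum_mem fun ij _ => nsmul_mem (R.mul_mem (hqR _) (ihR _)) _
    · rw [iterate_leibniz δ hδ]
      refine sum_mem fun ij hij => nsmul_mem ?_ _
      replace hij := Finset.HasAntidiagonal.mem_antidiagonal.1 hij
      -- Either the first factor is undifferentiated, hence in `J`, or too few derivatives remain
      -- for the other factors.
      rcases Nat.eq_zero_or_pos ij.1 with h0 | h0
      · rw [h0]
        exact hr _ (ihR _) _ hq1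
      · exact hl _ (hqR _) _ (ihJ _ (by omega))
    -- Only the term with one derivative on the first factor survives modulo `J`; its coefficient
    -- `l.length + 1` builds the factorial.
    · rw [iterate_leibniz δ hδ, Finset.Nat.sum_antidiagonal_eq_sum_range_succ_mk,
        Finset.sum_range_succ', Finset.sum_range_succ']
      have e : δ q.1 * δ^[l.length] P - l.length.factorial • (q.2 * Q) ∈ J := by
        have e1 := hl _ (hqR 1) _ ihd
        have e2 := nsmul_mem (hr _ ihQ _ hq2) l.length.factorial
        have e3 := J.sub_mem e1 e2
        convert e3 using 1
        simp only [mul_sub, sub_mul, smul_sub, mul_smul_comm, Function.iterate_one]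
        abel
      have e' := nsmul_mem e (l.length + 1)
      have hs : ∑ k ∈ Finset.range l.length, (l.length + 1).choose (k + 1 + 1) •
          (δ^[k + 1 + 1] q.1 * δ^[l.length + 1 - (k + 1 + 1)] P) ∈ J := by
        refine sum_mem fun k hk => nsmul_mem (hl _ (hqR _) _ (ihJ _ ?_)) _
        rw [Finset.mem_range] at hk
        omega
      have h0 : (l.length + 1).choose 0 • (δ^[0] q.1 * δ^[l.length + 1 - 0] P) ∈ J :=
        nsmul_mem (hr _ (ihR _) _ hq1) _
      have := J.add_mem (J.add_mem hs e') h0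
      convert this using 1
      simp [Nat.factorial_succ, smul_sub, mul_smul]
      abel

/-! ### The filtration `N.lcs L` and nilpotency of ideals -/

section

variable {F L : Type*} [Field F] [LieRing L] [LieAlgebra F L]

theorem LieIdeal.lcs_antitone (N : LieIdeal F L) : Antitone (N.lcs L) :=
  antitone_nat_of_succ_le fun k => by
    rw [LieIdeal.lcs_succ]
    exact LieSubmodule.lie_le_right _ _

/-- The shift by one arises because `N.lcs L` starts at `L`; a first bracket with `N` lands in `N`.
-/
theorem LieIdeal.lcs_succ_eq_bot {N : LieIdeal F L} {c : ℕ}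
    (h : LieModule.lowerCentralSeries F N N c = ⊥) : N.lcs L (c + 1) = ⊥ := by
  have key : ∀ k, ∀ y ∈ N.lcs L (k + 1),
      ∃ z ∈ LieModule.lowerCentralSeries F N N k, (z : L) = y := by
    intro k
    induction k with
    | zero =>
      intro y hy
      have : y ∈ N := by
        rw [LieIdeal.lcs_succ] at hy
        exact LieSubmodule.lie_le_left _ _ hy
      exact ⟨⟨y, this⟩, by simp, rfl⟩
    | succ k ih =>
      intro y hy
      rw [LieIdeal.lcs_succ, ← LieSubmodule.mem_toSubmodule,
        LieSubmodule.lieIdeal_oper_eq_linear_span'] at hy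
      induction hy using Submodule.span_induction with
      | mem y hy =>
        obtain ⟨x, hx, n, hn, rfl⟩ := hy
        obtain ⟨z, hz, rfl⟩ := ih n hn
        refine ⟨⁅(⟨x, hx⟩ : N), z⁆, ?_, rfl⟩
        rw [LieModule.lowerCentralSeries_succ]
        exact LieSubmodule.lie_mem_lie (LieSubmodule.mem_top _) hz
      | zero => exact ⟨0, zero_mem _, rfl⟩
      | add a b _ _ ha hb =>
        obtain ⟨a', ha, rfl⟩ := ha
        obtain ⟨b', hb, rfl⟩ := hb
        exact ⟨a' + b', add_mem ha hb, rfl⟩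
      | smul t a _ ha =>
        obtain ⟨a', ha, rfl⟩ := ha
        exact ⟨t • a', (LieModule.lowerCentralSeries F N N (k + 1)).smul_mem t ha, rfl⟩
  rw [eq_bot_iff]
  intro y hy
  obtain ⟨z, hz, rfl⟩ := key c y hy
  rw [h, LieSubmodule.mem_bot] at hz
  simp [hz]

/-- `M` acts nilpotently on `L`, hence on its submodule `M`. -/
theorem LieIdeal.isNilpotent_of_lcs_eq_bot {M : LieIdeal F L} {k : ℕ} (h : M.lcs L k = ⊥) :
    LieRing.IsNilpotent M := by
  have h1 : LieModule.lowerCentralSeries F M L k = ⊥ := by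
    have := LieIdeal.coe_lcs_eq M L k
    rw [h] at this
    rw [← LieSubmodule.toSubmodule_eq_bot, ← this]
    rfl
  have : LieModule.IsNilpotent M L := LieModule.IsNilpotent.mk (L := M) (R := F) L h1
  have hfg : ∀ x m, ⁅(LieHom.id : M →ₗ⁅F⁆ M) x, M.toSubmodule.subtype m⁆ =
      M.toSubmodule.subtype ⁅x, m⁆ := fun _ _ => rfl
  exact Function.Injective.lieModuleIsNilpotent (f := (LieHom.id : M →ₗ⁅F⁆ M))
    (g := M.toSubmodule.subtype) hfg Subtype.val_injective

/-- The terms of the lower central series of an ideal are controlled by products of adjoint maps. -/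
theorem LieIdeal.iterate_lie_le {M : LieIdeal F L} {B : LieIdeal F L} {n : ℕ} :
    ∀ {A : LieIdeal F L}, (∀ l : List L, l.length = n → (∀ x ∈ l, x ∈ M) →
      ∀ a ∈ A, (l.map (LieAlgebra.ad F L)).prod a ∈ B) → (fun K => ⁅M, K⁆)^[n] A ≤ B := by
  induction n with
  | zero => exact fun h a ha => by simpa using h [] rfl (by simp) a ha
  | succ n ih =>
    intro A h
    rw [Function.iterate_succ_apply]
    refine ih fun l hl hlM a ha => ?_
    rw [← LieSubmodule.mem_toSubmodule, LieSubmodule.lieIdeal_oper_eq_linear_span'] at ha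
    induction ha using Submodule.span_induction with
    | mem y hy =>
      obtain ⟨x, hx, a, ha, rfl⟩ := hy
      have := h (l ++ [x]) (by simp [hl]) (by
        intro y hy
        rcases List.mem_append.1 hy with hy | hy
        · exact hlM y hy
        · rw [List.mem_singleton.1 hy]; exact hx) a ha
      simpa using this
    | zero => simp
    | add a b _ _ ha hb => rw [map_add]; exact add_mem ha hb
    | smul t a _ ha => rw [map_smul]; exact B.smul_mem t ha

end
-- Nilpotency of `N + D N`
section

variable {F L : Type*} [Field F] [LieRing L] [LieAlgebra F L]

/-- The ideal `N + D N`, for an ideal `N` and a derivation `D`. -/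
def LieIdeal.addDerivation (N : LieIdeal F L) (D : LieDerivation F L L) : LieIdeal F L where
  toSubmodule := N.toSubmodule ⊔ N.toSubmodule.map D.toLinearMap
  lie_mem := by
    intro x m hm
    obtain ⟨a, ha, b, ⟨n, hn, rfl⟩, rfl⟩ := Submodule.mem_sup.1 hm
    have h : ⁅x, a + D n⁆ = (⁅x, a⁆ - ⁅D x, n⁆) + D ⁅x, n⁆ := by
      rw [LieDerivation.apply_lie_eq_add, lie_add]; abel
    exact Submodule.mem_sup.2 ⟨⁅x, a⁆ - ⁅D x, n⁆, N.sub_mem (N.lie_mem ha) (N.lie_mem hn),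
      D ⁅x, n⁆, ⟨_, N.lie_mem hn, rfl⟩, h.symm⟩

theorem LieIdeal.mem_addDerivation {N : LieIdeal F L} {D : LieDerivation F L L} {y : L} :
    y ∈ N.addDerivation D ↔ ∃ a ∈ N, ∃ n ∈ N, a + D n = y := by
  refine Submodule.mem_sup.trans ⟨?_, ?_⟩
  · rintro ⟨a, ha, b, ⟨n, hn, rfl⟩, rfl⟩
    exact ⟨a, ha, n, hn, rfl⟩
  · rintro ⟨a, ha, n, hn, rfl⟩
    exact ⟨a, ha, D n, ⟨n, hn, rfl⟩, rfl⟩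

/-- The endomorphisms that preserve the terms of the lower central series of `N` on `L`. -/
def LieIdeal.lcsStabilizer (N : LieIdeal F L) : Subring (Module.End F L) where
  carrier := {T | ∀ i, ∀ y ∈ N.lcs L i, T y ∈ N.lcs L i}
  mul_mem' hS hT i y hy := hS i _ (hT i y hy)
  one_mem' _ _ hy := hy
  add_mem' hS hT i y hy := add_mem (hS i y hy) (hT i y hy)
  zero_mem' i _ _ := zero_mem (N.lcs L i)
  neg_mem' hT i y hy := neg_mem (hT i y hy)

/-- The endomorphisms that map each term of the lower central series of `N` on `L` to the next. -/
def LieIdeal.lcsShift (N : LieIdeal F L) : AddSubgroup (Module.End F L) where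
  carrier := {T | ∀ i, ∀ y ∈ N.lcs L i, T y ∈ N.lcs L (i + 1)}
  add_mem' hS hT i y hy := add_mem (hS i y hy) (hT i y hy)
  zero_mem' i _ _ := zero_mem (N.lcs L (i + 1))
  neg_mem' hT i y hy := neg_mem (hT i y hy)

theorem LieIdeal.ad_mem_lcsStabilizer (N : LieIdeal F L) (x : L) :
    LieAlgebra.ad F L x ∈ N.lcsStabilizer :=
  fun i _ hy => (N.lcs L i).lie_mem hy

theorem LieIdeal.ad_mem_lcsShift {N : LieIdeal F L} {x : L} (hx : x ∈ N) :
    LieAlgebra.ad F L x ∈ N.lcsShift := fun i y hy => by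
  rw [LieIdeal.lcs_succ]
  exact LieSubmodule.lie_mem_lie hx hy

/-- The derivation `T ↦ D ∘ T - T ∘ D` of the endomorphism ring. -/
def LieDerivation.endDerivation (D : LieDerivation F L L) :
    Module.End F L →+ Module.End F L where
  toFun T := D.toLinearMap * T - T * D.toLinearMap
  map_zero' := by simp
  map_add' S T := by rw [mul_add, add_mul]; abel

theorem LieDerivation.endDerivation_apply (D : LieDerivation F L L) (T : Module.End F L) :
    D.endDerivation T = D.toLinearMap * T - T * D.toLinearMap := rfl

theorem LieDerivation.endDerivation_ad (D : LieDerivation F L L) (x : L) :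
    D.endDerivation (LieAlgebra.ad F L x) = LieAlgebra.ad F L (D x) := by
  ext y
  change D ⁅x, y⁆ - ⁅x, D y⁆ = ⁅D x, y⁆
  rw [LieDerivation.apply_lie_eq_add]; abel

theorem LieDerivation.iterate_endDerivation_ad (D : LieDerivation F L L) (k : ℕ) (x : L) :
    D.endDerivation^[k] (LieAlgebra.ad F L x) = LieAlgebra.ad F L (D^[k] x) := by
  induction k generalizing x with
  | zero => rfl
  | succ k ih => rw [Function.iterate_succ_apply, endDerivation_ad, ih, Function.iterate_succ_apply]

theorem LieIdeal.list_prod_ad_mem_lcs {N : LieIdeal F L} (l : List L) (hl : ∀ x ∈ l, x ∈ N)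
    (y : L) : (l.map (LieAlgebra.ad F L)).prod y ∈ N.lcs L l.length := by
  induction l with
  | nil => simp
  | cons x l ih =>
    simp only [List.map_cons, List.prod_cons, List.length_cons]
    exact LieIdeal.ad_mem_lcsShift (hl x List.mem_cons_self) _ _
      (ih fun z hz => hl z (List.mem_cons_of_mem _ hz))

/-- Each `x` is `D a` modulo `N` for some `a ∈ N`. The product of the maps `ad a` is zero, so its
`n`-th derivative, congruent to `n!` times the product of the maps `ad x`, is zero as well. `D`
itself need not preserve the filtration: the derivatives of `ad a` are maps `ad (D^[k] a)`, which
do. -/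
theorem LieIdeal.list_prod_ad_mem_lcsShift {N : LieIdeal F L} {D : LieDerivation F L L} {n : ℕ}
    (hn : N.lcs L n = ⊥) (hf : (n.factorial : F) ≠ 0) (l : List L) (hln : l.length = n)
    (hl : ∀ x ∈ l, x ∈ N.addDerivation D) : (l.map (LieAlgebra.ad F L)).prod ∈ N.lcsShift := by
  have hx : ∀ x, x ∈ N.addDerivation D → ∃ a ∈ N, x - D a ∈ N := by
    intro x hx
    obtain ⟨b, hb, a, ha, rfl⟩ := LieIdeal.mem_addDerivation.1 hx
    exact ⟨a, ha, by simpa using hb⟩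
  choose! f hfN hf' using hx
  let l' : List (Module.End F L × Module.End F L) :=
    l.map fun x => (LieAlgebra.ad F L (f x), LieAlgebra.ad F L x)
  have h1 : (l'.map Prod.fst).prod = 0 := by
    have e : l'.map Prod.fst = (l.map f).map (LieAlgebra.ad F L) := by simp [l']
    rw [e]
    ext y
    have := LieIdeal.list_prod_ad_mem_lcs (N := N) (l.map f) (by
      intro z hz
      obtain ⟨x, hx, rfl⟩ := List.mem_map.1 hz
      exact hfN x (hl x hx)) y
    rw [List.length_map, hln, hn] at this
    simpa using this
  have h2 : l'.map Prod.snd = l.map (LieAlgebra.ad F L) := by simp [l']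
  have hδ : ∀ S T : Module.End F L, D.endDerivation (S * T) =
      D.endDerivation S * T + S * D.endDerivation T := by
    intro S T
    simp only [LieDerivation.endDerivation_apply, sub_mul, mul_sub, mul_assoc]
    abel
  have key := (iterate_derivation_list_prod D.endDerivation hδ N.lcsStabilizer N.lcsShift
    (fun T hT i y hy => N.lcs_antitone (Nat.le_succ i) (hT i y hy))
    (fun S hS T hT i y hy => hS _ _ (hT i y hy))
    (fun S hS T hT i y hy => hT _ _ (hS i y hy)) l' (by
      intro q hq
      obtain ⟨x, hx, rfl⟩ := List.mem_map.1 hq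
      refine ⟨LieIdeal.ad_mem_lcsShift (hfN x (hl x hx)), fun k => ?_, ?_⟩
      · rw [LieDerivation.iterate_endDerivation_ad]
        exact N.ad_mem_lcsStabilizer _
      · rw [LieDerivation.endDerivation_ad, ← map_sub]
        exact LieIdeal.ad_mem_lcsShift (hf' x (hl x hx)))).2.2.2
  rw [h1, h2, Function.iterate_fixed (map_zero _), zero_sub, neg_mem_iff] at key
  have hlen : l'.length = n := by simp [l', hln]
  rw [hlen] at key
  intro i y hy
  have := (N.lcs L (i + 1)).smul_mem (n.factorial : F)⁻¹ (key i y hy)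
  rwa [LinearMap.smul_apply, ← Nat.cast_smul_eq_nsmul F, smul_smul, inv_mul_cancel₀ hf,
    one_smul] at this

/-- If `N` is a nilpotent ideal whose class `c` satisfies `(c + 1)! ≠ 0` in `F`, then `N + D N` is
nilpotent for every derivation `D`. -/
theorem LieIdeal.isNilpotent_addDerivation {N : LieIdeal F L} (D : LieDerivation F L L) {c : ℕ}
    (hc : LieModule.lowerCentralSeries F N N c = ⊥) (hf : ((c + 1).factorial : F) ≠ 0) :
    LieRing.IsNilpotent (N.addDerivation D) := by
  have hn := LieIdeal.lcs_succ_eq_bot hc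
  have key : ∀ i, (N.addDerivation D).lcs L ((c + 1) * i) ≤ N.lcs L i := by
    intro i
    induction i with
    | zero => simp
    | succ i ih =>
      have e : (N.addDerivation D).lcs L ((c + 1) * (i + 1)) =
          (fun K => ⁅N.addDerivation D, K⁆)^[c + 1]
            ((N.addDerivation D).lcs L ((c + 1) * i)) := by
        rw [LieIdeal.lcs, LieIdeal.lcs, ← Function.iterate_add_apply, mul_add, mul_one, add_comm]
      rw [e]
      exact LieIdeal.iterate_lie_le fun l hl hlM a ha =>
        LieIdeal.list_prod_ad_mem_lcsShift hn hf l hl hlM i a (ih ha)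
  exact LieIdeal.isNilpotent_of_lcs_eq_bot (k := (c + 1) * (c + 1))
    (eq_bot_iff.2 (hn ▸ key (c + 1)))

/-- A nilpotent ideal that contains every nilpotent ideal containing it is characteristic, provided its
class is small with respect to the characteristic. -/
theorem LieIdeal.derivation_mem_of_maximal {N : LieIdeal F L}
    (hmax : ∀ M : LieIdeal F L, LieRing.IsNilpotent M → N ≤ M → M ≤ N) {c : ℕ}
    (hc : LieModule.lowerCentralSeries F N N c = ⊥) (hf : ((c + 1).factorial : F) ≠ 0)
    (D : LieDerivation F L L) {x : L} (hx : x ∈ N) : D x ∈ N :=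
  hmax _ (LieIdeal.isNilpotent_addDerivation D hc hf)
    (fun a ha => LieIdeal.mem_addDerivation.2 ⟨a, ha, 0, zero_mem N, by simp⟩)
    (LieIdeal.mem_addDerivation.2 ⟨0, zero_mem N, x, hx, by simp⟩)

/-! ### Passing from an ideal to the ambient algebra -/

/-- Let `f` embed `U` as an ideal of `L`. A nilpotent ideal of `U` of small class that is not properly
contained in any other nilpotent ideal of `U` is mapped into the nilradical of `L`. -/
theorem LieHom.map_mem_lieNilradical_of_maximal {U : Type*} [LieRing U] [LieAlgebra F U]
    (f : U →ₗ⁅F⁆ L) (hf : Function.Injective f) (hideal : ∀ (d : L) u, ∃ v, f v = ⁅d, f u⁆)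
    {N : LieIdeal F U} (hmax : ∀ M : LieIdeal F U, LieRing.IsNilpotent M → N ≤ M → M ≤ N) {c : ℕ}
    (hc : LieModule.lowerCentralSeries F N N c = ⊥) (hfac : ((c + 1).factorial : F) ≠ 0)
    {x : U} (hx : x ∈ N) : f x ∈ lieNilradical F L := by
  choose g hg using hideal
  -- `ad d` restricted to the ideal `f U` and pulled back along `f`.
  let D (d : L) : LieDerivation F U U :=
    { toFun := g d
      map_add' := fun a b => hf (by simp [hg])
      map_smul' := fun t a => hf (by simp [hg])
      leibniz' := fun a b => hf (by
        simp only [LinearMap.coe_mk, AddHom.coe_mk, hg, LieHom.map_lie, map_sub]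
        rw [leibniz_lie, ← lie_skew (f b)]
        abel) }
  let K : LieIdeal F L :=
    { N.toSubmodule.map f.toLinearMap with
      lie_mem := by
        rintro d _ ⟨n, hn, rfl⟩
        exact ⟨D d n, LieIdeal.derivation_mem_of_maximal hmax hc hfac (D d) hn, hg d n⟩ }
  have hK : ∀ n : N, f n ∈ K := fun n => ⟨n, n.2, rfl⟩
  let φ : N →ₗ⁅F⁆ K :=
    { toFun := fun n => ⟨f n, hK n⟩
      map_add' := fun a b => Subtype.ext (map_add f (a : U) b)
      map_smul' := fun t a => Subtype.ext (map_smul f t (a : U))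
      map_lie' := fun {a b} => Subtype.ext (LieHom.map_lie f (a : U) b) }
  have hφ : Function.Surjective φ := by
    rintro ⟨_, ⟨n, hn, rfl⟩⟩
    exact ⟨⟨n, hn⟩, rfl⟩
  have : LieRing.IsNilpotent N := LieModule.IsNilpotent.mk (L := N) (R := F) N hc
  have hKn : LieRing.IsNilpotent K := hφ.lieAlgebra_isNilpotent
  exact (le_sSup hKn : K ≤ lieNilradical F L) (hK ⟨x, hx⟩)

theorem LieHom.map_mem_lieNilradical_of_isNilregular {U : Type*} [LieRing U] [LieAlgebra F U]
    [FiniteDimensional F U] (f : U →ₗ⁅F⁆ L) (hf : Function.Injective f)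
    (hideal : ∀ (d : L) u, ∃ v, f v = ⁅d, f u⁆) (hU : IsNilregular F U) {x : U}
    (hx : x ∈ lieNilradical F U) : f x ∈ lieNilradical F L := by
  obtain ⟨p, hp⟩ := CharP.exists F
  rcases Nat.eq_zero_or_pos p with rfl | hp0
  · have : CharZero F := CharP.charP_to_charZero F
    have hle : lieNilradical F U ≤ (lieNilradical F L).comap f := by
      refine sSup_le fun J hJ => ?_
      -- Enlarging `J` to a maximal nilpotent ideal avoids having to know that the sum of all
      -- nilpotent ideals is nilpotent.
      obtain ⟨N, ⟨hN, hJN⟩, hmax⟩ := (wellFounded_gt (α := LieIdeal F U)).has_min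
        {M | LieRing.IsNilpotent M ∧ J ≤ M} ⟨J, hJ, le_rfl⟩
      obtain ⟨c, hc⟩ := LieModule.IsNilpotent.nilpotent F N N
      intro y hy
      rw [LieIdeal.mem_comap]
      exact f.map_mem_lieNilradical_of_maximal hf hideal (fun M hM hNM => (eq_of_le_of_not_lt hNM
        (hmax M ⟨hM, hJN.trans hNM⟩)).ge) hc
        (Nat.cast_ne_zero.2 (Nat.factorial_ne_zero _)) (hJN hy)
    exact LieIdeal.mem_comap.1 (hle hx)
  · obtain ⟨c, hcp, hc, -⟩ := hU p hp0 hp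
    have hprime : p.Prime := (CharP.char_is_prime_or_zero F p).resolve_right hp0.ne'
    refine f.map_mem_lieNilradical_of_maximal hf hideal (fun M hM _ => le_sSup hM) hc ?_ hx
    -- The class bound `c < p - 1` says `c + 1 < p`, so `p` does not divide `(c + 1)!`.
    rw [Ne, CharP.cast_eq_zero_iff F p, hprime.dvd_factorial]
    omega

end

theorem theoremt {F L : Type*} [Field F] [LieRing L] [LieAlgebra F L] [FiniteDimensional F L] :
    (∀ I : LieIdeal F L, IsNilregular F I →
      ∀ x : I, x ∈ lieNilradical F I → (x : L) ∈ lieNilradical F L) ∧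
    (∀ I : LieSubalgebra F L, IsSubideal I → IsNilregular F I →
      (∀ J : LieSubalgebra F L, IsSubideal J → I ≤ J → IsNilregular F J) →
      ∀ x : I, x ∈ lieNilradical F I → (x : L) ∈ lieNilradical F L) := by
  refine ⟨fun I hI x hx => ?_, ?_⟩
  · have : FiniteDimensional F I := inferInstanceAs (FiniteDimensional F I.toSubmodule)
    exact LieHom.map_mem_lieNilradical_of_isNilregular I.incl Subtype.val_injective
      (fun d u => ⟨⁅d, u⁆, rfl⟩) hI hx
  rintro I ⟨n, C, rfl, hCn, hC⟩ - hreg x hx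
  have hmono : ∀ j ≤ n, C 0 ≤ C j := by
    intro j
    induction j with
    | zero => exact fun _ => le_rfl
    | succ j ih => exact fun hj => (ih (by omega)).trans (hC j (by omega)).1.le
  have hsub : ∀ j ≤ n, IsSubideal (C j) := fun j hj =>
    ⟨n - j, fun k => C (j + k), rfl, by simpa [Nat.add_sub_cancel' hj] using hCn,
      fun k hk => hC (j + k) (by omega)⟩
  have key : ∀ j (hj : j ≤ n), (⟨x, hmono j hj x.2⟩ : C j) ∈ lieNilradical F (C j) := by
    intro j
    induction j with
    | zero => exact fun _ => hx
    | succ j ih =>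
      intro hj
      have hj' : j ≤ n := by omega
      obtain ⟨hlt, hid⟩ := hC j (by omega)
      exact LieHom.map_mem_lieNilradical_of_isNilregular (LieSubalgebra.inclusion hlt.le)
        (LieSubalgebra.inclusion_injective hlt.le)
        (fun d u => ⟨⟨⁅(d : L), (u : L)⁆, hid d d.2 u u.2⟩, rfl⟩)
        (hreg _ (hsub j hj') (hmono j hj')) (ih hj')
  -- `C n = ⊤` is still a subalgebra, not `L` itself, so its inclusion into `L` is one more ideal
  -- embedding.
  exact LieHom.map_mem_lieNilradical_of_isNilregular (C n).incl Subtype.val_injective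
    (fun d u => ⟨⟨⁅d, (u : L)⁆, by simp [hCn]⟩, rfl⟩)
    (hreg _ (hsub n le_rfl) (hmono n le_rfl)) (key n le_rfl)
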